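/- For a positive integer $n$, let $R(n)$ denote the largest cardinality of a family $\mathcal G$ of (simple, not necessarily connected) graphs on the vertex set $[n]=\{1,\dots,n\}$ such that every vertex has degree $2$ in each member of $\mathcal G$, and such that the union of any two different members of $\mathcal G$ has maximum degree at least $4$ (equivalently, exactly $4$); here the union of two graphs on $[n]$ is the graph on $[n]$ whose edge set is the union of their edge sets. Then $$ R(n)\;\le\; e^{\sqrt{n}}\,\frac{n!}{\lfloor n/3\rfloor!}\qquad\text{for every } n\ge 1,$$ and there is an absolute constant $c>0$ such that $$ c\cdot\frac{n!}{\lfloor n/3\rfloor!\;6^{n/3}}\;\le\; R(n)\qquad\text{for every } n\ge 3 .$$ Moreover, if $n$ is a multiple of $3$, the last inequality holds with $c=1$. -/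

import Mathlib

/-- For families `F` and `D` of graphs on the vertex set `Fin n`, the largest cardinality of a
subfamily of `F` in which the union of any two different members belongs to `D`. -/
noncomputable def maxFamily (n : ℕ) (F D : Set (SimpleGraph (Fin n))) : ℕ :=
  sSup {m : ℕ | ∃ G : Finset (SimpleGraph (Fin n)),
    (G : Set (SimpleGraph (Fin n))) ⊆ F ∧
    (∀ A ∈ G, ∀ B ∈ G, A ≠ B → A ⊔ B ∈ D) ∧ G.card = m}

/-- The supremum in `maxFamily` is attained: it is a maximum. -/
theorem maxFamily_isGreatest (n : ℕ) (F D : Set (SimpleGraph (Fin n))) :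
    IsGreatest {m : ℕ | ∃ G : Finset (SimpleGraph (Fin n)),
      (G : Set (SimpleGraph (Fin n))) ⊆ F ∧
      (∀ A ∈ G, ∀ B ∈ G, A ≠ B → A ⊔ B ∈ D) ∧ G.card = m} (maxFamily n F D) := by
  classical
  have hb : BddAbove {m : ℕ | ∃ G : Finset (SimpleGraph (Fin n)),
      (G : Set (SimpleGraph (Fin n))) ⊆ F ∧
      (∀ A ∈ G, ∀ B ∈ G, A ≠ B → A ⊔ B ∈ D) ∧ G.card = m} := by
    refine ⟨Fintype.card (SimpleGraph (Fin n)), ?_⟩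
    rintro m ⟨G, -, -, rfl⟩
    exact Finset.card_le_univ G
  exact ⟨Nat.sSup_mem ⟨0, ∅, by simp, by simp, by simp⟩ hb, fun m hm => le_csSup hb hm⟩

open Classical in
/-- The graphs on `Fin n` of uniform degree 2 (not necessarily connected). -/
def twoRegularGraphs (n : ℕ) : Set (SimpleGraph (Fin n)) :=
  {G | G.IsRegularOfDegree 2}

open Classical in
/-- The graphs on `Fin n` of maximum degree at least 4. -/
def maxDegreeAtLeastFour (n : ℕ) : Set (SimpleGraph (Fin n)) :=
  {G | 4 ≤ G.maxDegree}

/-- `R n` is the largest cardinality of a family of 2-regular graphs on `n` vertices in which the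
union of any two different members has a vertex of degree 4. -/
noncomputable def R (n : ℕ) : ℕ :=
  maxFamily n (twoRegularGraphs n) (maxDegreeAtLeastFour n)

/-!
The union of two 2-regular graphs has a vertex of degree 4 exactly when they share no edge at some
vertex. Upper bound: every 2-regular graph contains a minimal edge cover, which is a disjoint union
of two-leaf stars and single edges. Different members of the family have no edge cover in common,
so it suffices to count these covers. They fall into at most `⌊n/3⌋ + 1` isomorphism types according
to the number of two-leaf stars; each type has at least `⌊n/3⌋!` automorphisms and so at most
`n! / ⌊n/3⌋!` labelings.

Lower bound: for a disjoint union `F` of `k` triangles and `r ≤ 2` four-cycles, choose a maximal set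
of labelings of `F` no two of which share an edge at every vertex. Labelings that do share an edge
at every vertex differ by a permutation that maps triangles to triangles: the image of a triangle
lies in a single component, which cannot be a four-cycle since a single vertex of it would be
missed. There are `k! 6^k (4r)!` such permutations.
-/

open SimpleGraph

section Degrees

variable {n : ℕ} {A B G : SimpleGraph (Fin n)}

theorem mem_twoRegularGraphs : G ∈ twoRegularGraphs n ↔ ∀ v, (G.neighborSet v).ncard = 2 := by
  classical
  simp only [twoRegularGraphs, Set.mem_ofPred_eq, IsRegularOfDegree, Set.ncard_eq_toFinset_card',
    ← card_neighborFinset_eq_degree, neighborFinset]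

theorem mem_maxDegreeAtLeastFour :
    G ∈ maxDegreeAtLeastFour n ↔ ∃ v, 4 ≤ (G.neighborSet v).ncard := by
  classical
  simp only [maxDegreeAtLeastFour, Set.mem_ofPred_eq, Set.ncard_eq_toFinset_card',
    ← neighborFinset_def, card_neighborFinset_eq_degree]
  refine ⟨fun hG => ?_, fun ⟨v, hv⟩ => hv.trans ?_⟩
  · by_contra! hdeg
    have hmax : 4 ≤ G.maxDegree := by convert hG
    exact hmax.not_gt (Nat.lt_succ_of_le
      (G.maxDegree_le_of_forall_degree_le 3 fun v => Nat.le_of_lt_succ (hdeg v)))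
  · convert G.degree_le_maxDegree v

theorem support_eq_univ_of_mem_twoRegularGraphs (hG : G ∈ twoRegularGraphs n) :
    G.support = Set.univ := by
  refine Set.eq_univ_of_forall fun v => ?_
  have hv : (G.neighborSet v).ncard ≠ 0 := by simp [mem_twoRegularGraphs.1 hG]
  exact Set.nonempty_of_ncard_ne_zero hv

theorem sup_mem_maxDegreeAtLeastFour_iff (hA : A ∈ twoRegularGraphs n)
    (hB : B ∈ twoRegularGraphs n) :
    A ⊔ B ∈ maxDegreeAtLeastFour n ↔ (A ⊓ B).support ≠ Set.univ := by
  rw [mem_maxDegreeAtLeastFour, Set.ne_univ_iff_exists_notMem]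
  refine exists_congr fun v => ?_
  have h := Set.ncard_union_add_ncard_inter (A.neighborSet v) (B.neighborSet v)
  rw [mem_twoRegularGraphs.1 hA, mem_twoRegularGraphs.1 hB] at h
  have hinf : v ∉ (A ⊓ B).support ↔ (A.neighborSet v ∩ B.neighborSet v).ncard = 0 := by
    rw [Set.ncard_eq_zero, Set.eq_empty_iff_forall_notMem, mem_support, not_exists]
    rfl
  have hsup : (A ⊔ B).neighborSet v = A.neighborSet v ∪ B.neighborSet v := rfl
  rw [hinf, hsup]
  omega

theorem card_le_R {𝒢 : Finset (SimpleGraph (Fin n))} (h𝒢 : ∀ G ∈ 𝒢, G ∈ twoRegularGraphs n)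
    (hinf : ∀ A ∈ 𝒢, ∀ B ∈ 𝒢, A ≠ B → (A ⊓ B).support ≠ Set.univ) : 𝒢.card ≤ R n :=
  (maxFamily_isGreatest n (twoRegularGraphs n) (maxDegreeAtLeastFour n)).2 ⟨𝒢, h𝒢,
    fun A hA B hB hAB =>
      (sup_mem_maxDegreeAtLeastFour_iff (h𝒢 A hA) (h𝒢 B hB)).2 (hinf A hA B hB hAB), rfl⟩

theorem exists_card_eq_R (n : ℕ) : ∃ 𝒢 : Finset (SimpleGraph (Fin n)),
    (∀ G ∈ 𝒢, G ∈ twoRegularGraphs n) ∧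
    (∀ A ∈ 𝒢, ∀ B ∈ 𝒢, A ≠ B → (A ⊓ B).support ≠ Set.univ) ∧ 𝒢.card = R n := by
  obtain ⟨𝒢, h𝒢, hsup, hcard⟩ :=
    (maxFamily_isGreatest n (twoRegularGraphs n) (maxDegreeAtLeastFour n)).1
  exact ⟨𝒢, h𝒢, fun A hA B hB hAB =>
    (sup_mem_maxDegreeAtLeastFour_iff (h𝒢 hA) (h𝒢 hB)).1 (hsup A hA B hB hAB), hcard⟩

theorem one_le_R (hn : 3 ≤ n) : 1 ≤ R n := by
  classical
  obtain ⟨m, rfl⟩ := Nat.exists_eq_add_of_le' hn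
  have h : cycleGraph (m + 3) ∈ twoRegularGraphs (m + 3) := fun v => by
    convert cycleGraph_degree_three_le (v := v)
  simpa using card_le_R (𝒢 := {cycleGraph (m + 3)}) (by simpa using h) (by simp)

end Degrees

section Automorphisms

variable {α β V W : Type*}

/-- The disjoint union of copies of `G` indexed by `α`, encoded as the box product of `G` with the
edgeless graph on `α`. -/
def disjointCopies (α : Type*) (G : SimpleGraph V) : SimpleGraph (α × V) :=
  ⊥ □ G

@[simp]
theorem disjointCopies_adj {G : SimpleGraph V} {x y : α × V} :
    (disjointCopies α G).Adj x y ↔ x.1 = y.1 ∧ G.Adj x.2 y.2 := by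
  simp [disjointCopies, and_comm]

theorem ncard_neighborSet_disjointCopies (G : SimpleGraph V) (x : α × V) :
    ((disjointCopies α G).neighborSet x).ncard = (G.neighborSet x.2).ncard := by
  simp [disjointCopies, neighborSet_boxProd, Set.ncard_prod]

/-- The isomorphism of disjoint unions that sends the copy with index `a` to the copy with index
`σ a` by means of the automorphism `ρ a`. -/
def disjointCopiesIso {G : SimpleGraph V} (σ : α ≃ β) (ρ : α → (G ≃g G)) :
    disjointCopies α G ≃g disjointCopies β G where
  toEquiv := σ.prodShear fun a => (ρ a).toEquiv
  map_rel_iff' {x y} := by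
    simp only [disjointCopies_adj, Equiv.prodShear_apply, σ.injective.eq_iff]
    refine and_congr_right fun h => ?_
    rw [h]
    exact (ρ y.1).map_rel_iff

instance [Finite V] [Finite W] (F : SimpleGraph V) (G : SimpleGraph W) : Finite (F ≃g G) :=
  DFunLike.finite _

theorem factorial_mul_pow_card_le_card_iso_disjointCopies [Finite α] [Finite V] [Nonempty V]
    (G : SimpleGraph V) :
    (Nat.card α).factorial * Nat.card (G ≃g G) ^ Nat.card α ≤
      Nat.card (disjointCopies α G ≃g disjointCopies α G) := by
  rw [← Nat.card_perm, ← Nat.card_fun, ← Nat.card_prod]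
  refine Nat.card_le_card_of_injective
    (fun p : Equiv.Perm α × (α → (G ≃g G)) => disjointCopiesIso p.1 p.2) fun p q h => ?_
  have hpq (a : α) (v : V) : (p.1 a, p.2 a v) = (q.1 a, q.2 a v) := DFunLike.congr_fun h (a, v)
  refine Prod.ext (Equiv.ext fun a => ?_) (funext fun a => RelIso.ext fun v => ?_)
  · exact congrArg Prod.fst (hpq a (Classical.arbitrary V))
  · exact congrArg Prod.snd (hpq a v)

theorem card_iso_mul_card_iso_le_card_iso_sum [Finite V] [Finite W] (F : SimpleGraph V)
    (G : SimpleGraph W) :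
    Nat.card (F ≃g F) * Nat.card (G ≃g G) ≤ Nat.card (F ⊕g G ≃g F ⊕g G) := by
  rw [← Nat.card_prod]
  refine Nat.card_le_card_of_injective
    (fun p : (F ≃g F) × (G ≃g G) => Iso.sumCongr p.1 p.2) fun p q h => ?_
  refine Prod.ext (RelIso.ext fun v => ?_) (RelIso.ext fun w => ?_)
  · exact Sum.inl_injective (DFunLike.congr_fun h (.inl v))
  · exact Sum.inr_injective (DFunLike.congr_fun h (.inr w))

theorem eq_of_iso_toEquiv_eq {F : SimpleGraph W} {G H : SimpleGraph V} (e : F ≃g G) (f : F ≃g H)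
    (h : e.toEquiv = f.toEquiv) : G = H :=
  calc G = F.comap e.toEquiv.symm := e.symm.toEmbedding.comap_eq.symm
    _ = F.comap f.toEquiv.symm := by rw [h]
    _ = H := f.symm.toEmbedding.comap_eq

theorem card_mul_card_iso_le_factorial [Finite V] {F : SimpleGraph W}
    (𝒮 : Finset (SimpleGraph V)) (h𝒮 : ∀ H ∈ 𝒮, Nonempty (F ≃g H)) :
    𝒮.card * Nat.card (F ≃g F) ≤ (Nat.card V).factorial := by
  rcases 𝒮.eq_empty_or_nonempty with rfl | ⟨H₀, hH₀⟩
  · simp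
  let e : W ≃ V := (h𝒮 H₀ hH₀).some.toEquiv
  have := Finite.of_equiv V e.symm
  let φ (H : 𝒮) : F ≃g H.1 := (h𝒮 H.1 H.2).some
  have hcard : Nat.card (W ≃ V) = (Nat.card V).factorial := by
    rw [← Nat.card_perm, Nat.card_congr (e.equivCongr (Equiv.refl V))]
  rw [← hcard, ← Nat.card_eq_finsetCard, ← Nat.card_prod]
  refine Nat.card_le_card_of_injective
    (fun p : 𝒮 × (F ≃g F) => (p.2.trans (φ p.1)).toEquiv) ?_
  rintro ⟨H, ρ⟩ ⟨H', ρ'⟩ h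
  obtain rfl : H = H' :=
    Subtype.ext (eq_of_iso_toEquiv_eq (ρ.trans (φ H)) (ρ'.trans (φ H')) h)
  exact Prod.ext rfl (RelIso.ext fun w => (φ H).injective (DFunLike.congr_fun h w))

end Automorphisms

section EdgeCovers

variable {V W : Type*} {F : SimpleGraph W} {H : SimpleGraph V}

/-- `H` has no isolated vertices, and no proper subgraph of `H` on the same vertex set has this
property: the edges of `H` form a minimal edge cover of `V`. -/
abbrev IsMinimalEdgeCover (H : SimpleGraph V) : Prop :=
  Minimal (fun K : SimpleGraph V => K.support = Set.univ) H

theorem IsMinimalEdgeCover.neighborSet_eq_singleton_or (hH : IsMinimalEdgeCover H)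
    {u v : V} (huv : H.Adj u v) :
    H.neighborSet u = {v} ∨ H.neighborSet v = {u} := by
  by_contra! hne
  have other {x y : V} (hxy : H.Adj x y) (hx : H.neighborSet x ≠ {y}) : ∃ z ≠ y, H.Adj x z := by
    by_contra! hz
    exact hx (Set.eq_singleton_iff_unique_mem.2 ⟨hxy, fun z hxz => by_contra fun h => hz z h hxz⟩)
  have hdel : (H.deleteEdges {s(u, v)}).support = Set.univ := by
    refine Set.eq_univ_of_forall fun w => ?_
    simp only [mem_support, deleteEdges_adj, Set.mem_singleton_iff, Sym2.eq_iff]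
    have := huv.ne
    rcases eq_or_ne w u with rfl | hwu
    · obtain ⟨z, hz, hwz⟩ := other huv hne.1
      exact ⟨z, hwz, by tauto⟩
    rcases eq_or_ne w v with rfl | hwv
    · obtain ⟨z, hz, hwz⟩ := other huv.symm hne.2
      exact ⟨z, hwz, by tauto⟩
    obtain ⟨z, hwz⟩ : w ∈ H.support := hH.prop ▸ Set.mem_univ w
    exact ⟨z, hwz, by tauto⟩
  have huv' := hH.le_of_le hdel (deleteEdges_le _) huv
  simp at huv'

theorem nonempty_iso_of_map_eq {f : W ↪ V} (hf : F.map f = H) (hH : H.support = Set.univ) :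
    Nonempty (F ≃g H) := by
  subst hf
  rw [support_map] at hH
  have hsurj : Function.Surjective f := Set.range_eq_univ.1
    (Set.eq_univ_of_univ_subset (hH.symm.subset.trans (Set.image_subset_range f F.support)))
  exact ⟨Iso.map (Equiv.ofBijective f ⟨f.injective, hsurj⟩) F⟩

/-- The vertices of degree 2. In a minimal edge cover of maximum degree 2 they are the centers of
the two-leaf stars. -/
def branchVertices (H : SimpleGraph V) : Set V :=
  {v | (H.neighborSet v).ncard = 2}

/-- The edges both of whose ends have degree 1, that is, the components with a single edge. -/
def isolatedEdges (H : SimpleGraph V) : Set (Sym2 V) :=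
  {e ∈ H.edgeSet | ∀ v ∈ e, (H.neighborSet v).ncard = 1}

theorem IsMinimalEdgeCover.exists_embedding_branchVertices [Finite V]
    (hH : IsMinimalEdgeCover H) :
    ∃ f : branchVertices H × Option Bool ↪ V, (∀ v, f (v, none) = v) ∧
      (∀ v : branchVertices H, H.neighborSet v = Set.range fun b => f (v, some b)) ∧
      ∀ v b, H.neighborSet (f (v, some b)) = {v.1} := by
  have hleaf (v : branchVertices H) : Nonempty (Bool ≃ H.neighborSet v) :=
    Finite.card_eq.1 (by simpa using v.2.symm)
  let leaf v := (hleaf v).some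
  have neighborSet_leaf (v) (b : Bool) : H.neighborSet (leaf v b) = {v.1} := by
    refine (hH.neighborSet_eq_singleton_or (leaf v b).2).resolve_left fun h => ?_
    simpa [branchVertices, h] using v.2
  have center_ne_leaf (v w : branchVertices H) (b : Bool) : v.1 ≠ leaf w b := fun h => by
    simpa [branchVertices, h, neighborSet_leaf] using v.2
  refine ⟨⟨fun x => x.2.elim x.1.1 fun b => leaf x.1 b, ?_⟩, fun v => rfl, fun v => ?_,
    neighborSet_leaf⟩
  · rintro ⟨v, _ | b⟩ ⟨w, _ | c⟩ h
    · exact congrArg (·, none) (Subtype.ext h)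
    · exact (center_ne_leaf v w c h).elim
    · exact (center_ne_leaf w v b h.symm).elim
    · obtain rfl : v = w := Subtype.ext (Set.singleton_injective
        ((neighborSet_leaf v b).symm.trans ((congrArg _ h).trans (neighborSet_leaf w c))))
      rw [(leaf v).injective (Subtype.ext h)]
  · change _ = Set.range (Subtype.val ∘ leaf v)
    rw [(leaf v).surjective.range_comp, Subtype.range_coe]

theorem exists_embedding_isolatedEdges (H : SimpleGraph V) :
    ∃ g : isolatedEdges H × Bool ↪ V, (∀ e, e.1 = s(g (e, false), g (e, true))) ∧
      ∀ e b, H.neighborSet (g (e, b)) = {g (e, !b)} := by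
  have hends (e : isolatedEdges H) : ∃ x : Bool → V, ∀ b, e.1 = s(x b, x !b) := by
    obtain ⟨u, v⟩ := e.1
    exact ⟨fun b => cond b v u, Bool.rec rfl Sym2.eq_swap⟩
  choose x hx using hends
  have hadj (e) (b : Bool) : H.Adj (x e b) (x e !b) := by
    rw [← mem_edgeSet, ← hx]
    exact e.2.1
  have neighborSet_end (e) (b : Bool) : H.neighborSet (x e b) = {x e !b} := by
    obtain ⟨w, hw⟩ := Set.ncard_eq_one.1 (e.2.2 (x e b) (hx e b ▸ Sym2.mem_mk_left _ _))
    have hxw : x e (!b) ∈ ({w} : Set V) := hw ▸ hadj e b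
    rw [hw, Set.mem_singleton_iff.1 hxw]
  refine ⟨⟨fun p => x p.1 p.2, ?_⟩, fun e => hx e false, neighborSet_end⟩
  rintro ⟨e, b⟩ ⟨e', b'⟩ (h : x e b = x e' b')
  have hother : x e (!b) = x e' !b' := Set.singleton_injective
    ((neighborSet_end e b).symm.trans ((congrArg _ h).trans (neighborSet_end e' b')))
  obtain rfl : e = e' := Subtype.ext (by rw [hx e b, hx e' b', h, hother])
  rcases Bool.eq_or_eq_not b b' with rfl | rfl
  · rfl
  · exact ((hadj e b').ne h.symm).elim

theorem mem_isolatedEdges_or_exists_mem_branchVertices [Finite V]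
    (hdeg : ∀ v, (H.neighborSet v).ncard ≤ 2) {e : Sym2 V} (he : e ∈ H.edgeSet) :
    e ∈ isolatedEdges H ∨ ∃ v ∈ branchVertices H, ∃ u, H.Adj v u ∧ e = s(v, u) := by
  by_contra! h
  refine h.1 ⟨he, fun v hv => ?_⟩
  obtain ⟨u, rfl⟩ := Sym2.mem_iff_exists.1 hv
  have hne : (H.neighborSet v).ncard ≠ 2 := fun hbranch => h.2 v hbranch u he rfl
  have hpos : 0 < (H.neighborSet v).ncard := (Set.ncard_pos (Set.toFinite _)).2 ⟨u, he⟩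
  have := hdeg v
  omega

/-- The disjoint union of two-leaf stars indexed by `α` and single edges indexed by `β`. -/
def starForest (α β : Type*) : SimpleGraph (α × Option Bool ⊕ β × Bool) :=
  disjointCopies α (starGraph none) ⊕g disjointCopies β ⊤

theorem edgeSet_starForest (α β : Type*) :
    (starForest α β).edgeSet =
      Set.range (fun p : α × Bool => s(.inl (p.1, none), .inl (p.1, some p.2))) ∪
        Set.range (fun b : β => s(.inr (b, false), .inr (b, true))) := by
  ext e
  induction e with | _ x y
  rcases x with ⟨a, _ | x⟩ | ⟨b, _ | _⟩ <;> rcases y with ⟨a', _ | x'⟩ | ⟨b', _ | _⟩ <;>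
    simp [starForest, eq_comm]

theorem IsMinimalEdgeCover.nonempty_iso_starForest [Finite V]
    (hH : IsMinimalEdgeCover H) (hdeg : ∀ v, (H.neighborSet v).ncard ≤ 2) :
    Nonempty (starForest (branchVertices H) (isolatedEdges H) ≃g H) := by
  obtain ⟨f, hcenter, hleaves, hleaf⟩ := hH.exists_embedding_branchVertices
  obtain ⟨g, hedge, hend⟩ := exists_embedding_isolatedEdges H
  have center_ne_end (v : branchVertices H) (p) : v.1 ≠ g p := fun h => by
    simpa [branchVertices, h, hend] using v.2
  have hfg : Function.Injective (Sum.elim f g) := by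
    refine f.injective.sumElim g.injective ?_
    rintro ⟨v, _ | b⟩ ⟨e, c⟩ h
    · exact center_ne_end v (e, c) ((hcenter v).symm.trans h)
    · exact center_ne_end v (e, !c) (Set.singleton_injective
        ((hleaf v b).symm.trans ((congrArg _ h).trans (hend e c))))
  refine nonempty_iso_of_map_eq (f := ⟨Sum.elim f g, hfg⟩) ?_ hH.prop
  rw [← edgeSet_inj, edgeSet_map, edgeSet_starForest, Set.image_union, ← Set.range_comp,
    ← Set.range_comp]
  refine Set.Subset.antisymm (Set.union_subset ?_ ?_) fun e he => ?_
  · rintro _ ⟨⟨v, b⟩, rfl⟩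
    change H.Adj (f (v, none)) (f (v, some b))
    rw [hcenter, ← mem_neighborSet, hleaves]
    exact ⟨b, rfl⟩
  · rintro _ ⟨e, rfl⟩
    change s(g (e, false), g (e, true)) ∈ H.edgeSet
    rw [← hedge]
    exact e.2.1
  · rcases mem_isolatedEdges_or_exists_mem_branchVertices hdeg he with
      he | ⟨v, hv, u, hvu, rfl⟩
    · exact .inr ⟨⟨e, he⟩, (hedge ⟨e, he⟩).symm⟩
    · rw [← mem_neighborSet, hleaves ⟨v, hv⟩] at hvu
      obtain ⟨b, rfl⟩ := hvu
      exact .inl ⟨(⟨v, hv⟩, b), congrArg (fun w => s(w, f (⟨v, hv⟩, some b))) (hcenter _)⟩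

theorem nonempty_starForest_iso {α α' β β' : Type*} (σ : α ≃ α') (τ : β ≃ β') :
    Nonempty (starForest α β ≃g starForest α' β') :=
  ⟨Iso.sumCongr (disjointCopiesIso σ fun _ => .refl) (disjointCopiesIso τ fun _ => .refl)⟩

end EdgeCovers

section UpperBound

theorem one_lt_card_iso_starGraph {V : Type*} [Finite V] {r u v : V} (hu : u ≠ r) (hv : v ≠ r)
    (huv : u ≠ v) : 1 < Nat.card (starGraph r ≃g starGraph r) := by
  classical
  have hr : Equiv.swap u v r = r := Equiv.swap_apply_of_ne_of_ne hu.symm hv.symm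
  have hswap (x : V) : Equiv.swap u v x = r ↔ x = r := by
    rw [← Equiv.eq_symm_apply, Equiv.symm_swap, hr]
  exact Finite.one_lt_card_iff_nontrivial.2 ⟨⟨Equiv.swap u v, by simp [hswap]⟩, .refl, fun h =>
    huv (by simpa using (DFunLike.congr_fun h u).symm)⟩

theorem one_lt_card_iso_top (V : Type*) [Finite V] [Nontrivial V] :
    1 < Nat.card ((⊤ : SimpleGraph V) ≃g (⊤ : SimpleGraph V)) := by
  classical
  obtain ⟨u, v, huv⟩ := exists_pair_ne V
  exact Finite.one_lt_card_iff_nontrivial.2 ⟨Iso.completeGraph (.swap u v), .refl, fun h =>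
    huv ((DFunLike.congr_fun h u).symm.trans (Equiv.swap_apply_left u v))⟩

theorem factorial_add_le (t s : ℕ) :
    (t + s).factorial ≤ (t.factorial * 2 ^ t) * (s.factorial * 2 ^ s) := by
  calc (t + s).factorial = (t + s).choose s * t.factorial * s.factorial :=
        (Nat.add_choose_mul_factorial_mul_factorial t s).symm
    _ ≤ 2 ^ (t + s) * t.factorial * s.factorial := by
        gcongr
        exact Nat.choose_le_two_pow _ _
    _ = _ := by ring

theorem factorial_card_add_card_le_card_iso_starForest (α β : Type*) [Finite α] [Finite β] :
    (Nat.card α + Nat.card β).factorial ≤ Nat.card (starForest α β ≃g starForest α β) := by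
  refine (factorial_add_le _ _).trans <|
    (Nat.mul_le_mul (.trans ?_ (factorial_mul_pow_card_le_card_iso_disjointCopies _))
      (.trans ?_ (factorial_mul_pow_card_le_card_iso_disjointCopies _))).trans
      (card_iso_mul_card_iso_le_card_iso_sum _ _)
  · gcongr
    exact one_lt_card_iso_starGraph (u := some true) (v := some false) nofun nofun nofun
  · gcongr
    exact one_lt_card_iso_top Bool

variable {V : Type*} [Finite V] {H : SimpleGraph V}

theorem IsMinimalEdgeCover.card_eq (hH : IsMinimalEdgeCover H)
    (hdeg : ∀ v, (H.neighborSet v).ncard ≤ 2) :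
    Nat.card V = 3 * Nat.card (branchVertices H) + 2 * Nat.card (isolatedEdges H) := by
  obtain ⟨φ⟩ := hH.nonempty_iso_starForest hdeg
  rw [← Nat.card_congr φ.toEquiv]
  simp [Nat.card_sum, Nat.card_prod, mul_comm]

theorem card_mul_factorial_le_of_card_branchVertices_eq {𝒮 : Finset (SimpleGraph V)} {t : ℕ}
    (hmin : ∀ H ∈ 𝒮, IsMinimalEdgeCover H) (hdeg : ∀ H ∈ 𝒮, ∀ v, (H.neighborSet v).ncard ≤ 2)
    (ht : ∀ H ∈ 𝒮, Nat.card (branchVertices H) = t) :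
    𝒮.card * (Nat.card V / 3).factorial ≤ (Nat.card V).factorial := by
  rcases 𝒮.eq_empty_or_nonempty with rfl | ⟨H₀, hH₀⟩
  · simp
  have hcard {H} (hH : H ∈ 𝒮) := (hmin H hH).card_eq (hdeg H hH)
  have hiso (H) (hH : H ∈ 𝒮) :
      Nonempty (starForest (branchVertices H₀) (isolatedEdges H₀) ≃g H) := by
    have h₀ := hcard hH₀
    rw [hcard hH, ht H hH, ht H₀ hH₀] at h₀
    obtain ⟨σ⟩ := Finite.card_eq.1 ((ht H₀ hH₀).trans (ht H hH).symm)
    obtain ⟨τ⟩ : Nonempty (isolatedEdges H₀ ≃ isolatedEdges H) := Finite.card_eq.1 (by omega)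
    obtain ⟨φ⟩ := nonempty_starForest_iso σ τ
    obtain ⟨ψ⟩ := (hmin H hH).nonempty_iso_starForest (hdeg H hH)
    exact ⟨φ.trans ψ⟩
  calc 𝒮.card * (Nat.card V / 3).factorial
      ≤ 𝒮.card * (Nat.card (branchVertices H₀) + Nat.card (isolatedEdges H₀)).factorial := by
        gcongr
        have := hcard hH₀
        omega
    _ ≤ 𝒮.card * Nat.card (starForest (branchVertices H₀) (isolatedEdges H₀) ≃g
          starForest (branchVertices H₀) (isolatedEdges H₀)) := by
        gcongr
        exact factorial_card_add_card_le_card_iso_starForest _ _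
    _ ≤ (Nat.card V).factorial := card_mul_card_iso_le_factorial 𝒮 hiso

theorem card_le_of_isMinimalEdgeCover {𝒮 : Finset (SimpleGraph V)}
    (hmin : ∀ H ∈ 𝒮, IsMinimalEdgeCover H) (hdeg : ∀ H ∈ 𝒮, ∀ v, (H.neighborSet v).ncard ≤ 2) :
    𝒮.card ≤ (Nat.card V).factorial / (Nat.card V / 3).factorial * (Nat.card V / 3 + 1) := by
  classical
  refine (Finset.card_le_mul_card_image_of_maps_to (f := fun H => Nat.card (branchVertices H))
    (t := Finset.range (Nat.card V / 3 + 1)) (fun H hH => ?_) _ fun t _ => ?_).trans_eq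
    (by rw [Finset.card_range])
  · have := (hmin H hH).card_eq (hdeg H hH)
    rw [Finset.mem_range]
    omega
  · simp only [Nat.le_div_iff_mul_le (Nat.factorial_pos _)]
    exact card_mul_factorial_le_of_card_branchVertices_eq (t := t)
      (fun H hH => hmin H (Finset.mem_filter.1 hH).1)
      (fun H hH => hdeg H (Finset.mem_filter.1 hH).1) fun H hH => (Finset.mem_filter.1 hH).2

theorem R_le_mul (n : ℕ) : R n ≤ n.factorial / (n / 3).factorial * (n / 3 + 1) := by
  classical
  obtain ⟨𝒢, hreg, hinf, hcard⟩ := exists_card_eq_R n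
  have hcover (G) (hG : G ∈ 𝒢) :=
    exists_minimal_le_of_wellFoundedLT (fun K : SimpleGraph (Fin n) => K.support = Set.univ) G
      (support_eq_univ_of_mem_twoRegularGraphs (hreg G hG))
  choose! cover hle hmin using hcover
  have hinj : Set.InjOn cover 𝒢 := by
    refine fun A hA B hB hAB => by_contra fun hne => hinf A hA B hB hne ?_
    refine Set.eq_univ_of_univ_subset ((hmin A hA).prop.symm.subset.trans ?_)
    exact support_mono (le_inf (hle A hA) (hAB ▸ hle B hB))
  rw [← hcard, ← Finset.card_image_of_injOn hinj]
  refine (card_le_of_isMinimalEdgeCover (Finset.forall_mem_image.2 hmin)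
    (Finset.forall_mem_image.2 fun G hG v => ?_)).trans_eq (by rw [Nat.card_fin])
  exact (Set.ncard_le_ncard fun u hu => hle G hG hu).trans
    (mem_twoRegularGraphs.1 (hreg G hG) v).le

theorem R_le (n : ℕ) : (R n : ℝ) ≤
    Real.exp (Real.sqrt n) * (n.factorial / (n / 3 : ℕ).factorial) := by
  have hexp : ((n / 3 : ℕ) + 1 : ℝ) ≤ Real.exp (Real.sqrt n) := by
    have hquad := Real.quadratic_le_exp_of_nonneg (Real.sqrt_nonneg n)
    have hdiv : ((n / 3 : ℕ) : ℝ) ≤ (n : ℝ) / 3 := Nat.cast_div_le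
    rw [Real.sq_sqrt n.cast_nonneg] at hquad
    linarith [Real.sqrt_nonneg n, n.cast_nonneg (α := ℝ)]
  calc (R n : ℝ) ≤ (n.factorial / (n / 3).factorial : ℕ) * ((n / 3 : ℕ) + 1) := by
        exact_mod_cast R_le_mul n
    _ ≤ n.factorial / (n / 3 : ℕ).factorial * Real.exp (Real.sqrt n) := by
        gcongr
        exact Nat.cast_div_le
    _ = _ := mul_comm _ _

end UpperBound

section Packing

theorem exists_isSeparated_card_le_card_mul {X : Type*} [Finite X] (U : SetRel X X) [U.IsRefl]
    [U.IsSymm] {d : ℕ} (hd : ∀ x, {y | (y, x) ∈ U}.ncard ≤ d) :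
    ∃ E : Finset X, U.IsSeparated (E : Set X) ∧ Nat.card X ≤ E.card * d := by
  classical
  have := Fintype.ofFinite X
  obtain ⟨N, -, hN⟩ := (Set.toFinite {N : Set X | N ⊆ Set.univ ∧ U.IsSeparated N}).exists_le_maximal
    ⟨Set.empty_subset _, SetRel.IsSeparated.empty⟩
  refine ⟨N.toFinset, by simpa using hN.prop.2, ?_⟩
  have hcover : Finset.univ ⊆ N.toFinset.biUnion fun x => {y | (y, x) ∈ U} := fun y _ => by
    simpa using SetRel.IsCover.of_maximal_isSeparated hN (Set.mem_univ y)
  rw [Nat.card_eq_fintype_card, ← Finset.card_univ]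
  refine (Finset.card_le_card hcover).trans (Finset.card_biUnion_le_card_mul _ _ _ fun x _ => ?_)
  simpa [Set.ncard_eq_toFinset_card'] using hd x

theorem comap_mem_twoRegularGraphs {W : Type*} {n : ℕ} {F : SimpleGraph W}
    (hF : ∀ w, (F.neighborSet w).ncard = 2) (e : Fin n ≃ W) : F.comap e ∈ twoRegularGraphs n := by
  refine mem_twoRegularGraphs.2 fun v => ?_
  rw [← hF (e v)]
  exact Set.ncard_preimage_of_injective_subset_range e.injective
    (e.surjective.range_eq ▸ Set.subset_univ _)

/-- The relabelings `π` for which `F` and its pullback along `π` share an edge at every vertex.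
Their number bounds the labelings of `F` that a single labeling excludes in a greedy packing. -/
def overlappingPerms {W : Type*} (F : SimpleGraph W) : Set (Equiv.Perm W) :=
  {π | (F ⊓ F.comap π).support = Set.univ}

theorem symm_trans_mem_overlappingPerms_iff {V W : Type*} {F : SimpleGraph W} (e f : V ≃ W) :
    e.symm.trans f ∈ overlappingPerms F ↔ (F.comap e ⊓ F.comap f).support = Set.univ := by
  simp only [overlappingPerms, Set.mem_ofPred_eq, Set.eq_univ_iff_forall,
    mem_support, inf_adj, comap_adj, e.forall_congr_left, e.exists_congr_left,
    Equiv.apply_symm_apply, Equiv.trans_apply]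

theorem factorial_le_R_mul_ncard_overlappingPerms {W : Type*} [Finite W] {F : SimpleGraph W}
    (hF : ∀ w, (F.neighborSet w).ncard = 2) :
    (Nat.card W).factorial ≤ R (Nat.card W) * (overlappingPerms F).ncard := by
  classical
  let e₀ : W ≃ Fin (Nat.card W) := Finite.equivFin W
  let U : SetRel (Fin (Nat.card W) ≃ W) (Fin (Nat.card W) ≃ W) :=
    {p | (F.comap p.1 ⊓ F.comap p.2).support = Set.univ}
  have hreg (e : Fin (Nat.card W) ≃ W) := comap_mem_twoRegularGraphs hF e
  have mem_of_eq {e f : Fin (Nat.card W) ≃ W} (h : F.comap e = F.comap f) : (e, f) ∈ U := by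
    simpa [U, h] using support_eq_univ_of_mem_twoRegularGraphs (hreg f)
  have : U.IsRefl := ⟨fun e => mem_of_eq rfl⟩
  have : U.IsSymm := ⟨fun e f h => by simpa [U, inf_comm] using h⟩
  have hball (e : Fin (Nat.card W) ≃ W) : {f | (f, e) ∈ U}.ncard ≤
      (overlappingPerms F).ncard := by
    refine Set.ncard_le_ncard_of_injOn (fun f => f.symm.trans e) (fun f hf => ?_)
      fun f _ g _ h => ?_
    · exact (symm_trans_mem_overlappingPerms_iff f e).2 hf
    · exact Equiv.symm_bijective.injective
        (Equiv.ext fun w => e.injective (DFunLike.congr_fun h w))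
  obtain ⟨E, hE, hcard⟩ := exists_isSeparated_card_le_card_mul U hball
  have hinj : Set.InjOn (fun e : Fin (Nat.card W) ≃ W => F.comap e) E := fun e he f hf h =>
    by_contra fun hne => hE he hf hne (mem_of_eq h)
  have hER : E.card ≤ R (Nat.card W) := by
    rw [← Finset.card_image_of_injOn hinj]
    refine card_le_R (Finset.forall_mem_image.2 fun e _ => hreg e) ?_
    simp only [Finset.forall_mem_image]
    exact fun e he f hf hne => hE he hf fun h => hne (by rw [h])
  calc (Nat.card W).factorial = Nat.card (Fin (Nat.card W) ≃ W) := by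
        rw [← Nat.card_perm, Nat.card_congr (e₀.equivCongr (Equiv.refl W))]
    _ ≤ _ := hcard.trans (Nat.mul_le_mul_right _ hER)

end Packing

section Triangles

theorem eq_of_forall_exists_ne {γ K : Type*} [Finite γ] (hγ : Nat.card γ ≤ 3) {f : γ → K}
    (hf : ∀ a, ∃ b ≠ a, f b = f a) (a b : γ) : f a = f b := by
  classical
  by_contra hab
  obtain ⟨a', ha', hfa⟩ := hf a
  obtain ⟨b', hb', hfb⟩ := hf b
  have hcard : ({a, a', b, b'} : Finset γ).card = 4 := by
    have hab' : a ≠ b := fun h => hab (h ▸ rfl)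
    have : a ≠ b' := fun h => hab (h ▸ hfb)
    have : a' ≠ b := fun h => hab (h ▸ hfa.symm)
    have : a' ≠ b' := fun h => hab (hfa.symm.trans (h ▸ hfb))
    grind
  have := Fintype.ofFinite γ
  have := hcard ▸ Finset.card_le_univ ({a, a', b, b'} : Finset γ)
  rw [← Nat.card_eq_fintype_card] at this
  omega

theorem ncard_preimage_ne_of_mapsTo {W K : Type*} [Finite W] {F : SimpleGraph W} {c : W → K}
    (hc : ∀ u v, F.Adj u v → c u = c v) {π : Equiv.Perm W}
    (hπ : π ∈ overlappingPerms F) {k l : K}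
    (hkl : Set.MapsTo π (c ⁻¹' {k}) (c ⁻¹' {l})) :
    (c ⁻¹' {l}).ncard ≠ (c ⁻¹' {k}).ncard + 1 := by
  intro hcard
  -- If `π` sent all of `k` into `l` and missed a single vertex `π w` of `l`, then a neighbor `u` of
  -- `w` with `π u` adjacent to `π w` would have to lie in `k`, and so would `w`.
  have hdiff : (c ⁻¹' {l} \ π '' (c ⁻¹' {k})).ncard = 1 := by
    rw [Set.ncard_sdiff hkl.image_subset, Set.ncard_image_of_injective _ π.injective, hcard]
    simp
  obtain ⟨y, hy⟩ := Set.ncard_eq_one.1 hdiff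
  obtain ⟨w, rfl⟩ := π.surjective y
  have hw : π w ∈ c ⁻¹' {l} \ π '' (c ⁻¹' {k}) := hy ▸ rfl
  obtain ⟨u, hwu, hπwu⟩ : w ∈ (F ⊓ F.comap π).support := hπ ▸ Set.mem_univ w
  have hu : π u ∈ π '' (c ⁻¹' {k}) := by
    by_contra hu
    have : π u ∈ ({π w} : Set W) := hy ▸ ⟨(hc _ _ hπwu).symm.trans hw.1, hu⟩
    exact hwu.ne (π.injective this).symm
  rw [π.injective.mem_set_image] at hu
  exact hw.2 (Set.mem_image_of_mem π ((hc _ _ hwu).trans hu))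

theorem ncard_preimage_map_fst_inl {α β γ δ : Type*} (i : α) :
    ((Sum.map Prod.fst Prod.fst : α × γ ⊕ β × δ → α ⊕ β) ⁻¹' {.inl i}).ncard = Nat.card γ := by
  have : (Sum.map Prod.fst Prod.fst : α × γ ⊕ β × δ → α ⊕ β) ⁻¹' {.inl i} =
      Set.range fun c => .inl (i, c) := by
    ext (⟨_, _⟩ | _) <;> simp [eq_comm]
  rw [this, Set.ncard_range_of_injective]
  exact Sum.inl_injective.comp (Prod.mk_right_injective i)

theorem ncard_preimage_map_fst_inr {α β γ δ : Type*} (j : β) :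
    ((Sum.map Prod.fst Prod.fst : α × γ ⊕ β × δ → α ⊕ β) ⁻¹' {.inr j}).ncard = Nat.card δ := by
  have : (Sum.map Prod.fst Prod.fst : α × γ ⊕ β × δ → α ⊕ β) ⁻¹' {.inr j} =
      Set.range fun d => .inr (j, d) := by
    ext (_ | ⟨_, _⟩) <;> simp [eq_comm]
  rw [this, Set.ncard_range_of_injective]
  exact Sum.inr_injective.comp (Prod.mk_right_injective j)

/-- The disjoint union of triangles indexed by `α` and four-cycles indexed by `β`. -/
def triangleSquareGraph (α β : Type*) : SimpleGraph (α × Fin 3 ⊕ β × Fin 4) :=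
  disjointCopies α ⊤ ⊕g disjointCopies β (cycleGraph 4)

variable {α β γ : Type*}

theorem ncard_neighborSet_triangleSquareGraph (x : α × Fin 3 ⊕ β × Fin 4) :
    ((triangleSquareGraph α β).neighborSet x).ncard = 2 := by
  rcases x with x | x
  · rw [triangleSquareGraph, neighborSet_sum_inl, Set.ncard_image_of_injective _ Sum.inl_injective,
      ncard_neighborSet_disjointCopies, Set.ncard_eq_toFinset_card', ← neighborFinset,
      card_neighborFinset_eq_degree, complete_graph_degree, Fintype.card_fin]
  · rw [triangleSquareGraph, neighborSet_sum_inr, Set.ncard_image_of_injective _ Sum.inr_injective,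
      ncard_neighborSet_disjointCopies, Set.ncard_eq_toFinset_card', ← neighborFinset,
      card_neighborFinset_eq_degree, cycleGraph_degree_three_le]

theorem map_fst_eq_of_adj_triangleSquareGraph {x y : α × Fin 3 ⊕ β × Fin 4}
    (h : (triangleSquareGraph α β).Adj x y) :
    Sum.map Prod.fst Prod.fst x = Sum.map Prod.fst Prod.fst y := by
  rcases x with x | x <;> rcases y with y | y <;> simp_all [triangleSquareGraph]

theorem exists_forall_map_fst_apply_inl_eq [Finite α] [Finite β]
    {π : Equiv.Perm (α × Fin 3 ⊕ β × Fin 4)}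
    (hπ : π ∈ overlappingPerms (triangleSquareGraph α β)) (i : α) :
    ∃ i' : α, ∀ a, Sum.map Prod.fst Prod.fst (π (.inl (i, a))) = .inl i' := by
  have hconst (a : Fin 3) : Sum.map Prod.fst Prod.fst (π (.inl (i, a))) =
      Sum.map Prod.fst Prod.fst (π (.inl (i, 0))) := by
    refine eq_of_forall_exists_ne (f := fun a => Sum.map Prod.fst Prod.fst (π (.inl (i, a))))
      (by simp) (fun a => ?_) a 0
    obtain ⟨⟨j, b⟩ | _, hadj, hπadj⟩ :
        (.inl (i, a)) ∈ (triangleSquareGraph α β ⊓ (triangleSquareGraph α β).comap π).support :=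
      hπ ▸ Set.mem_univ _
    · obtain ⟨rfl, hab⟩ : i = j ∧ a ≠ b := by simpa [triangleSquareGraph] using hadj
      exact ⟨b, hab.symm, (map_fst_eq_of_adj_triangleSquareGraph hπadj).symm⟩
    · simp [triangleSquareGraph] at hadj
  rcases hj : Sum.map Prod.fst Prod.fst (π (.inl (i, 0))) with i' | j
  · exact ⟨i', fun a => (hconst a).trans hj⟩
  · refine absurd ?_ (ncard_preimage_ne_of_mapsTo
      (fun _ _ => map_fst_eq_of_adj_triangleSquareGraph) hπ (k := .inl i) (l := .inr j) ?_)
    · rw [ncard_preimage_map_fst_inl, ncard_preimage_map_fst_inr, Nat.card_fin, Nat.card_fin]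
    · rintro (⟨i', a⟩ | _) h
      · obtain rfl : i' = i := by simpa using h
        exact (hconst a).trans hj
      · simp at h

theorem exists_prodShear_eq [Finite α] [Finite γ] [Nonempty γ] {π : Equiv.Perm (α × γ)}
    (hπ : ∀ a, ∃ a', ∀ c, (π (a, c)).1 = a') :
    ∃ (σ : Equiv.Perm α) (τ : α → Equiv.Perm γ), Equiv.prodShear σ τ = π := by
  choose σ hσ using hπ
  have hσ_bij : σ.Bijective := Finite.surjective_iff_bijective.1 fun a' => by
    obtain ⟨⟨a, c⟩, hac⟩ := π.surjective (a', Classical.arbitrary γ)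
    exact ⟨a, by rw [← hσ a c, hac]⟩
  have hτ_bij (a : α) : (fun c => (π (a, c)).2).Bijective :=
    Finite.injective_iff_bijective.1 fun c d h =>
      Prod.mk_right_injective a (π.injective (Prod.ext ((hσ a c).trans (hσ a d).symm) h))
  exact ⟨.ofBijective σ hσ_bij, fun a => .ofBijective _ (hτ_bij a),
    Equiv.ext fun x => Prod.ext (hσ x.1 x.2).symm rfl⟩

theorem exists_sumCongr_prodShear_eq {δ : Type*} [Finite α] [Finite γ] [Nonempty γ] [Finite δ]
    {π : Equiv.Perm (α × γ ⊕ δ)} (hπ : ∀ a, ∃ a', ∀ c, ∃ d, π (.inl (a, c)) = .inl (a', d)) :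
    ∃ (σ : Equiv.Perm α) (τ : α → Equiv.Perm γ) (ρ : Equiv.Perm δ),
      Equiv.sumCongr (Equiv.prodShear σ τ) ρ = π := by
  obtain ⟨⟨π₁, ρ⟩, rfl⟩ : π ∈ (Equiv.Perm.sumCongrHom (α × γ) δ).range := by
    refine Equiv.Perm.mem_sumCongrHom_range_of_perm_mapsTo_inl ?_
    rintro _ ⟨⟨a, c⟩, rfl⟩
    obtain ⟨a', ha'⟩ := hπ a
    obtain ⟨d, hd⟩ := ha' c
    exact ⟨(a', d), hd.symm⟩
  obtain ⟨σ, τ, rfl⟩ := exists_prodShear_eq (π := π₁) fun a => by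
    obtain ⟨a', ha'⟩ := hπ a
    refine ⟨a', fun c => ?_⟩
    obtain ⟨d, hd⟩ := ha' c
    exact congrArg Prod.fst (Sum.inl_injective hd)
  exact ⟨σ, τ, ρ, rfl⟩

theorem ncard_overlappingPerms_triangleSquareGraph_le [Finite α] [Finite β] :
    (overlappingPerms (triangleSquareGraph α β)).ncard ≤
      (Nat.card α).factorial * 6 ^ Nat.card α * (4 * Nat.card β).factorial := by
  let Φ : (Equiv.Perm α × (α → Equiv.Perm (Fin 3))) × Equiv.Perm (β × Fin 4) →
      Equiv.Perm (α × Fin 3 ⊕ β × Fin 4) := fun p =>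
    Equiv.sumCongr (Equiv.prodShear p.1.1 p.1.2) p.2
  have hsub : overlappingPerms (triangleSquareGraph α β) ⊆ Set.range Φ := fun π hπ => by
    obtain ⟨σ, τ, ρ, h⟩ := exists_sumCongr_prodShear_eq (π := π) fun i => by
      obtain ⟨i', hi'⟩ := exists_forall_map_fst_apply_inl_eq hπ i
      refine ⟨i', fun a => ?_⟩
      rcases hx : π (.inl (i, a)) with ⟨j, b⟩ | x
      · obtain rfl : j = i' := by simpa [hx] using hi' a
        exact ⟨b, rfl⟩
      · simpa [hx] using hi' a
    exact ⟨((σ, τ), ρ), h⟩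
  calc _ ≤ (Set.range Φ).ncard := Set.ncard_le_ncard hsub (Set.toFinite _)
    _ ≤ Nat.card ((Equiv.Perm α × (α → Equiv.Perm (Fin 3))) × Equiv.Perm (β × Fin 4)) :=
      Finite.card_range_le Φ
    _ = _ := by
      simp only [Nat.card_prod, Nat.card_perm, Nat.card_fun, Nat.card_fin, mul_comm 4,
        Nat.factorial_succ, Nat.factorial_zero, Nat.reduceAdd, Nat.reduceMul]

end Triangles

section LowerBound

theorem factorial_le_R_mul {n k r : ℕ} (hn : n = 3 * k + 4 * r) :
    n.factorial ≤ R n * (k.factorial * 6 ^ k * (4 * r).factorial) := by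
  have hcard : Nat.card (Fin k × Fin 3 ⊕ Fin r × Fin 4) = n := by
    simp [hn, mul_comm]
  have h := factorial_le_R_mul_ncard_overlappingPerms
    (ncard_neighborSet_triangleSquareGraph (α := Fin k) (β := Fin r))
  rw [hcard] at h
  simpa using h.trans (Nat.mul_le_mul_left _ ncard_overlappingPerms_triangleSquareGraph_le)

theorem div_le_R_of_eq_three_mul_add_four_mul {n k r : ℕ} (hn : n = 3 * k + 4 * r) :
    (n.factorial : ℝ) / ((4 * r).factorial * ((n / 3 : ℕ).factorial * (6 : ℝ) ^ ((n : ℝ) / 3)))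
      ≤ R n := by
  have hk : (k.factorial : ℝ) ≤ (n / 3 : ℕ).factorial := by
    exact_mod_cast Nat.factorial_le (by omega)
  have hpow : (6 : ℝ) ^ k ≤ (6 : ℝ) ^ ((n : ℝ) / 3) := by
    rw [← Real.rpow_natCast]
    refine Real.rpow_le_rpow_of_exponent_le (by norm_num) ?_
    rw [hn]
    push_cast
    linarith [Nat.cast_nonneg (α := ℝ) r]
  rw [div_le_iff₀ (by positivity)]
  calc (n.factorial : ℝ) ≤ R n * (k.factorial * 6 ^ k * (4 * r).factorial) := by
        exact_mod_cast factorial_le_R_mul hn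
    _ = R n * ((4 * r).factorial * (k.factorial * 6 ^ k)) := by ring
    _ ≤ _ := by gcongr

theorem one_div_mul_le_R {n : ℕ} (hn : 3 ≤ n) :
    1 / ((8).factorial : ℝ) *
      ((n.factorial : ℝ) / (((n / 3 : ℕ).factorial : ℝ) * (6 : ℝ) ^ ((n : ℝ) / 3))) ≤ R n := by
  rw [div_mul_div_comm, one_mul]
  -- Among the `n ≥ 3`, only 5 is not of the form `3 * k + 4 * r` with `r ≤ 2`.
  rcases eq_or_ne n 5 with rfl | h5
  · have hpow : (1 : ℝ) ≤ (6 : ℝ) ^ (((5 : ℕ) : ℝ) / 3) :=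
      Real.one_le_rpow (by norm_num) (by positivity)
    refine (div_le_one_of_le₀ ?_ (by positivity)).trans (Nat.one_le_cast.2 (one_le_R hn))
    norm_num [Nat.factorial] at hpow ⊢
    linarith
  · obtain ⟨k, r, hr, h⟩ : ∃ k r, r ≤ 2 ∧ n = 3 * k + 4 * r :=
      ⟨(n - 4 * (n % 3)) / 3, n % 3, by omega, by omega⟩
    refine le_trans ?_ (div_le_R_of_eq_three_mul_add_four_mul h)
    gcongr
    omega

end LowerBound

theorem theorem2 :
    (∃ c : ℝ, 0 < c ∧ ∀ n : ℕ, 3 ≤ n →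
      c * ((n.factorial : ℝ) / (((n / 3 : ℕ).factorial : ℝ) * (6 : ℝ) ^ ((n : ℝ) / 3)))
        ≤ (R n : ℝ)) ∧
    (∀ n : ℕ, 3 ∣ n →
      (n.factorial : ℝ) / (((n / 3 : ℕ).factorial : ℝ) * (6 : ℝ) ^ ((n : ℝ) / 3))
        ≤ (R n : ℝ)) ∧
    (∀ n : ℕ,
      (R n : ℝ) ≤
        Real.exp (Real.sqrt (n : ℝ)) * ((n.factorial : ℝ) / ((n / 3 : ℕ).factorial : ℝ))) := by
  refine ⟨⟨1 / ((8).factorial : ℝ), by positivity, fun n hn => one_div_mul_le_R hn⟩, ?_, R_le⟩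
  rintro n ⟨k, hk⟩
  simpa using div_le_R_of_eq_three_mul_add_four_mul (n := n) (k := k) (r := 0) (by omega)
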